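/- Let $d\ge 2$. Let $\langle x,y\rangle_L=-x_0y_0+\sum_{j=1}^d x_jy_j$ on $\mathbb{R}^{d+1}$, and let $\mathbb{H}^d=\{x\in\mathbb{R}^{d+1}:\langle x,x\rangle_L=-1,\ x_0>0\}$ be hyperbolic space in the Lorentz model, with tangent spaces $T_x\mathbb{H}^d=\{v:\langle x,v\rangle_L=0\}$, the Riemannian metric given by restricting $\langle\cdot,\cdot\rangle_L$ to them, the corresponding Riemannian volume measure, the distance $\rho(x,y)=\operatorname{arcosh}(-\langle x,y\rangle_L)$, and the origin $o=(1,0,\dots,0)$; identify $T_o\mathbb{H}^d$ with $\mathbb{R}^d$ by $(0,v)\leftrightarrow v$. For $\mu\in\mathbb{H}^d$ let $$\operatorname{Exp}_\mu(v)=\cosh(\|v\|)\,\mu+\sinh(\|v\|)\frac{v}{\|v\|}\quad(v\in T_\mu\mathbb{H}^d),\qquad \operatorname{Log}_\mu(x)=\frac{\rho(\mu,x)}{\sqrt{\langle\mu,x\rangle_L^2-1}}\bigl(x+\langle\mu,x\rangle_L\,\mu\bigr)\quad(x\ne\mu),$$ with $\|v\|=\sqrt{\langle v,v\rangle_L}$,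 $\operatorname{Exp}_\mu(0)=\mu$ and $\operatorname{Log}_\mu(\mu)=0$. Let $PT_{o\to\mu}:T_o\mathbb{H}^d\to T_\mu\mathbb{H}^d$ be parallel transport along the geodesic from $o$ to $\mu$, and let $\mathsf T_\mu(x)=PT_{o\to\mu}^{-1}(\operatorname{Log}_\mu(x))\in\mathbb{R}^d$. Let $\mu\in\mathbb{H}^d$, let $\Sigma$ be a symmetric positive definite real $d\times d$ matrix, and let $\mathrm{HWN}_d(\mu,\Sigma)$ be the law of $\operatorname{Exp}_\mu(PT_{o\to\mu}Z)$, where $Z\sim N_d(0,\Sigma)$. Then $r_\mu(x):=\|\mathsf T_\mu(x)\|$ equals $\rho(\mu,x)$ for every $x\in\mathbb{H}^d$, and $\mathrm{HWN}_d(\mu,\Sigma)$ has with respect to the hyperbolic Riemannian volume measure the (measurable) density $$p_{\mu,\Sigma}(x)=(2\pi)^{-d/2}|\Sigma|^{-1/2}\exp\Bigl(-\tfrac12\,\mathsf T_\mu(x)^\top\Sigma^{-1}\mathsf T_\mu(x)\Bigr)\Bigl(\frac{r_\mu(x)}{\sinh r_\mu(x)}\Bigr)^{d-1},\qquad x\in\mathbb{H}^d,$$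 where $|\Sigma|=\det\Sigma$ and the last factor is interpreted as $1$ at $x=\mu$. -/

import Mathlib

open MeasureTheory ProbabilityTheory

noncomputable section

namespace Lorentz

/-- The Lorentz bilinear form `⟨x, y⟩_L = -x₀ y₀ + ∑ⱼ xⱼ yⱼ` on `ℝ^(d+1)`. -/
def form {d : ℕ} (x y : Fin (d + 1) → ℝ) : ℝ :=
  -(x 0 * y 0) + ∑ j : Fin d, x j.succ * y j.succ

/-- The Lorentz model of `d`-dimensional hyperbolic space, with the topology and Borel
σ-algebra induced by `ℝ^(d+1)`. -/
abbrev Hyp (d : ℕ) : Type :=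
  {x : Fin (d + 1) → ℝ // form x x = -1 ∧ 0 < x 0}

section FormLemmas

variable {d : ℕ}

lemma form_comm (x y : Fin (d + 1) → ℝ) : form x y = form y x := by
  simp [form, mul_comm]

lemma form_add_left (x y z : Fin (d + 1) → ℝ) : form (x + y) z = form x z + form y z := by
  simp [form, add_mul, Finset.sum_add_distrib]; ring

lemma form_smul_left (c : ℝ) (x z : Fin (d + 1) → ℝ) : form (c • x) z = c * form x z := by
  simp only [form, Pi.smul_apply, smul_eq_mul, mul_assoc, ← Finset.mul_sum]; ring

lemma form_add_right (x y z : Fin (d + 1) → ℝ) : form z (x + y) = form z x + form z y := by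
  rw [form_comm, form_add_left, form_comm x, form_comm y]

lemma form_smul_right (c : ℝ) (x z : Fin (d + 1) → ℝ) : form z (c • x) = c * form z x := by
  rw [form_comm, form_smul_left, form_comm x]

lemma form_zero_left (z : Fin (d + 1) → ℝ) : form 0 z = 0 := by simp [form]

lemma form_zero_right (z : Fin (d + 1) → ℝ) : form z 0 = 0 := by simp [form]

lemma form_sub_left (x y z : Fin (d + 1) → ℝ) : form (x - y) z = form x z - form y z := by
  rw [sub_eq_add_neg, ← neg_one_smul ℝ y, form_add_left, form_smul_left]; ring

lemma form_sub_right (x y z : Fin (d + 1) → ℝ) : form z (x - y) = form z x - form z y := by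
  rw [form_comm, form_sub_left, form_comm x, form_comm y]

end FormLemmas

/-- The tangent space `T_x ℍ^d = {v : ⟨x, v⟩_L = 0}`, as a subspace of `ℝ^(d+1)`. -/
def tangent {d : ℕ} (x : Hyp d) : Submodule ℝ (Fin (d + 1) → ℝ) where
  carrier := {v | form x.1 v = 0}
  add_mem' {a b} ha hb := by
    simp only [Set.mem_ofPred_eq] at *
    rw [form_add_right, ha, hb, add_zero]
  zero_mem' := form_zero_right _
  smul_mem' c v hv := by
    simp only [Set.mem_ofPred_eq] at *
    rw [form_smul_right, hv, mul_zero]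

/-- The Riemannian norm of a tangent vector: the metric is the restriction of the Lorentz form. -/
def tnorm {d : ℕ} {x : Hyp d} (v : tangent x) : ℝ := √(form v.1 v.1)

section Positivity

variable {d : ℕ}

lemma form_tangent {x : Hyp d} (v : tangent x) : form x.1 v.1 = 0 := v.2

/-- The reversed Cauchy-Schwarz inequality, in the form used below. -/
lemma sq_le_form (x : Hyp d) {v : Fin (d + 1) → ℝ} (hv : form x.1 v = 0) :
    (v 0) ^ 2 * (x.1 0) ^ 2 ≤ ((x.1 0) ^ 2 - 1) * (form v v + (v 0) ^ 2) := by
  have hcs := Finset.sum_mul_sq_le_sq_mul_sq Finset.univ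
    (fun j : Fin d => x.1 j.succ) (fun j => v j.succ)
  have hx := x.2.1
  simp only [form] at hv hx ⊢
  simp only [← pow_two] at hx ⊢
  have h1 : ∑ j : Fin d, x.1 j.succ * v j.succ = x.1 0 * v 0 := by linarith
  have h2 : ∑ j : Fin d, (x.1 j.succ) ^ 2 = (x.1 0) ^ 2 - 1 := by linarith
  rw [h1, h2] at hcs
  nlinarith

lemma one_le_coord (x : Hyp d) : 1 ≤ (x.1 0) ^ 2 := by
  have hx := x.2.1
  have : 0 ≤ ∑ j : Fin d, x.1 j.succ * x.1 j.succ :=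
    Finset.sum_nonneg fun j _ => mul_self_nonneg _
  simp only [form] at hx
  nlinarith

lemma sq_le_form' (x : Hyp d) {v : Fin (d + 1) → ℝ} (hv : form x.1 v = 0) :
    (v 0) ^ 2 ≤ ((x.1 0) ^ 2 - 1) * form v v := by
  have := sq_le_form x hv
  nlinarith

lemma form_self_nonneg (x : Hyp d) {v : Fin (d + 1) → ℝ} (hv : form x.1 v = 0) :
    0 ≤ form v v := by
  have h1 := sq_le_form' x hv
  have h2 : 0 ≤ form v v + (v 0) ^ 2 := by
    have : 0 ≤ ∑ j : Fin d, v j.succ * v j.succ :=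
      Finset.sum_nonneg fun j _ => mul_self_nonneg _
    simp only [form]; nlinarith
  have h3 := one_le_coord x
  nlinarith [sq_nonneg (v 0)]

lemma eq_zero_of_form_self (x : Hyp d) {v : Fin (d + 1) → ℝ} (hv : form x.1 v = 0)
    (h : form v v = 0) : v = 0 := by
  have h1 := sq_le_form' x hv
  rw [h, mul_zero] at h1
  have h0 : v 0 = 0 := by nlinarith
  have hs : ∑ j : Fin d, v j.succ * v j.succ = 0 := by
    simp only [form, h0] at h; linarith
  rw [Finset.sum_eq_zero_iff_of_nonneg fun j _ => mul_self_nonneg _] at hs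
  funext i
  refine Fin.cases h0 (fun j => ?_) i
  simpa using hs j (Finset.mem_univ j)

lemma tnorm_sq {x : Hyp d} (v : tangent x) : (tnorm v) ^ 2 = form v.1 v.1 :=
  Real.sq_sqrt (form_self_nonneg x v.2)

lemma tnorm_nonneg {x : Hyp d} (v : tangent x) : 0 ≤ tnorm v := Real.sqrt_nonneg _

lemma eq_zero_of_tnorm {x : Hyp d} (v : tangent x) (h : tnorm v = 0) : v.1 = 0 := by
  apply eq_zero_of_form_self x v.2
  rw [← tnorm_sq, h]; simp

lemma tnorm_smul {x : Hyp d} (t : ℝ) (v : tangent x) : tnorm (t • v) = |t| * tnorm v := by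
  have h : form (t • v).1 (t • v).1 = t ^ 2 * form v.1 v.1 := by
    rw [Submodule.coe_smul, form_smul_left, form_smul_right]; ring
  rw [tnorm, h, Real.sqrt_mul (sq_nonneg t), Real.sqrt_sq_eq_abs, tnorm]

lemma expVec_mem (μ : Hyp d) (v : tangent μ) :
    form (Real.cosh (tnorm v) • μ.1 + Real.sinh (tnorm v) • ((tnorm v)⁻¹ • v.1))
      (Real.cosh (tnorm v) • μ.1 + Real.sinh (tnorm v) • ((tnorm v)⁻¹ • v.1)) = -1 ∧
    0 < (Real.cosh (tnorm v) • μ.1 + Real.sinh (tnorm v) • ((tnorm v)⁻¹ • v.1)) 0 := by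
  have hμ := μ.2.1
  have hμ0 := μ.2.2
  rcases eq_or_ne (tnorm v) 0 with h | h
  · simp [h, hμ, hμ0]
  have hn : 0 < tnorm v := lt_of_le_of_ne (tnorm_nonneg v) (Ne.symm h)
  constructor
  · simp only [form_add_left, form_add_right, form_smul_left, form_smul_right, form_tangent,
      form_comm v.1 μ.1, hμ, ← tnorm_sq]
    have := Real.cosh_sq (tnorm v)
    field_simp
    nlinarith
  · have h1 := sq_le_form' μ v.2
    rw [← tnorm_sq] at h1
    have h2 : |v.1 0| ≤ μ.1 0 * tnorm v := by
      apply abs_le_of_sq_le_sq _ (by positivity)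
      nlinarith
    have h3 : -(μ.1 0) ≤ (tnorm v)⁻¹ * v.1 0 := by
      rw [inv_mul_eq_div, le_div_iff₀ hn]
      linarith [neg_abs_le (v.1 0)]
    have h4 : 0 < Real.sinh (tnorm v) := Real.sinh_pos_iff.2 hn
    have h5 := Real.sinh_lt_cosh (tnorm v)
    simp only [Pi.add_apply, Pi.smul_apply, smul_eq_mul]
    nlinarith

end Positivity

/-- The origin `o = (1, 0, …, 0)`. -/
def origin (d : ℕ) : Hyp d :=
  ⟨Fin.cons 1 0, by simp [form], by simp⟩

/-- The hyperbolic distance `ρ(x, y) = arcosh (-⟨x, y⟩_L)`. -/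
def dist {d : ℕ} (x y : Hyp d) : ℝ := Real.arcosh (-form x.1 y.1)

/-- The exponential map `Exp_μ(v) = cosh ‖v‖ μ + sinh ‖v‖ v / ‖v‖`
(with `Exp_μ(0) = μ`, which the convention `0⁻¹ = 0` delivers). -/
def exp {d : ℕ} (μ : Hyp d) (v : tangent μ) : Hyp d :=
  ⟨Real.cosh (tnorm v) • μ.1 + Real.sinh (tnorm v) • ((tnorm v)⁻¹ • v.1), expVec_mem μ v⟩

/-- The logarithm map `Log_μ(x) = ρ(μ, x) / √(⟨μ, x⟩_L² - 1) (x + ⟨μ, x⟩_L μ)` for `x ≠ μ`, and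
`Log_μ(μ) = 0`. -/
def log {d : ℕ} (μ x : Hyp d) : tangent μ :=
  open Classical in
  if x = μ then 0 else
    ⟨(dist μ x / √((-form μ.1 x.1) ^ 2 - 1)) • (x.1 + form μ.1 x.1 • μ.1), by
      change form _ _ = 0
      rw [form_smul_right, form_add_right, form_smul_right, μ.2.1]; ring⟩

/-- The geodesic `t ↦ Exp_x(t Log_x(y))` from `x` (at `t = 0`) to `y` (at `t = 1`). -/
def geodesic {d : ℕ} (x y : Hyp d) (t : ℝ) : Hyp d := exp x (t • log x y)

/-- The Levi-Civita covariant derivative, along a curve `γ` in `ℍ^d`, of a vector field `V` along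
`γ`: the component of the ambient derivative `V'` tangent to `ℍ^d`, for the Lorentz form. -/
def covDeriv {d : ℕ} (γ : ℝ → Hyp d) (V : ℝ → Fin (d + 1) → ℝ) (t : ℝ) : Fin (d + 1) → ℝ :=
  deriv V t + form (γ t).1 (deriv V t) • (γ t).1

/-- `V` is a parallel tangent vector field along the curve `γ`. -/
structure IsParallel {d : ℕ} (γ : ℝ → Hyp d) (V : ℝ → Fin (d + 1) → ℝ) : Prop where
  mem_tangent : ∀ t, V t ∈ tangent (γ t)
  differentiable : Differentiable ℝ V
  covDeriv_eq_zero : ∀ t, covDeriv γ V t = 0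

/-- `w ∈ T_y ℍ^d` is obtained from `v ∈ T_x ℍ^d` by parallel transport along the geodesic from
`x` to `y`. -/
def IsTransport {d : ℕ} (x y : Hyp d) (v : tangent x) (w : tangent y) : Prop :=
  ∃ V : ℝ → Fin (d + 1) → ℝ, IsParallel (geodesic x y) V ∧ V 0 = v.1 ∧ V 1 = w.1

section Transport

variable {d : ℕ}

/-- The unit direction of the geodesic from `x` to `y` at `x` (zero if `x = y`). -/
def dir (x y : Hyp d) : Fin (d + 1) → ℝ := (tnorm (log x y))⁻¹ • (log x y).1

lemma form_dir (x y : Hyp d) : form x.1 (dir x y) = 0 := by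
  rw [dir, form_smul_right, form_tangent, mul_zero]

lemma dir_cases (x y : Hyp d) :
    (tnorm (log x y) = 0 ∧ dir x y = 0) ∨ form (dir x y) (dir x y) = 1 := by
  rcases eq_or_ne (tnorm (log x y)) 0 with h | h
  · left; simp [dir, h]
  · right
    rw [dir, form_smul_left, form_smul_right, ← tnorm_sq]
    field_simp

lemma geodesic_coe (x y : Hyp d) (t : ℝ) :
    (geodesic x y t).1 = Real.cosh (t * tnorm (log x y)) • x.1
      + Real.sinh (t * tnorm (log x y)) • dir x y := by
  simp only [geodesic, exp, tnorm_smul, Submodule.coe_smul, dir]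
  have hc : Real.cosh (|t| * tnorm (log x y)) = Real.cosh (t * tnorm (log x y)) := by
    rw [← Real.cosh_abs (t * _), abs_mul, abs_of_nonneg (tnorm_nonneg _)]
  rw [hc]
  congr 1
  rcases eq_or_ne t 0 with rfl | ht
  · simp
  rcases abs_cases t with ⟨h, _⟩ | ⟨h, _⟩ <;> rw [h]
  · rw [mul_inv, smul_smul, smul_smul, smul_smul]
    congr 1; field_simp
  · rw [neg_mul, Real.sinh_neg, smul_smul, smul_smul, smul_smul]
    congr 1
    rcases eq_or_ne (tnorm (log x y)) 0 with h0 | h0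
    · simp [h0]
    · field_simp

lemma geodesic_zero (x y : Hyp d) : geodesic x y 0 = x := by
  apply Subtype.ext; rw [geodesic_coe]; simp

lemma one_le_neg_form (x y : Hyp d) : 1 ≤ -form x.1 y.1 := by
  have hcs := Finset.sum_mul_sq_le_sq_mul_sq Finset.univ
    (fun j : Fin d => x.1 j.succ) (fun j => y.1 j.succ)
  have hx := x.2.1
  have hy := y.2.1
  have hx0 := x.2.2
  have hy0 := y.2.2
  simp only [form] at hx hy ⊢
  simp only [← pow_two] at hx hy
  set s := ∑ j : Fin d, x.1 j.succ * y.1 j.succ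
  have h1 : ∑ j : Fin d, (x.1 j.succ) ^ 2 = (x.1 0) ^ 2 - 1 := by linarith
  have h2 : ∑ j : Fin d, (y.1 j.succ) ^ 2 = (y.1 0) ^ 2 - 1 := by linarith
  rw [h1, h2] at hcs
  have h3 := one_le_coord x
  have h4 := one_le_coord y
  have hp : 1 ≤ x.1 0 * y.1 0 := by nlinarith [mul_pos hx0 hy0]
  have h5 : s ^ 2 ≤ (x.1 0 * y.1 0 - 1) ^ 2 := by nlinarith [sq_nonneg (x.1 0 - y.1 0)]
  have := abs_le_of_sq_le_sq h5 (by linarith)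
  linarith [this, le_abs_self s]

lemma eq_of_neg_form_eq_one {x y : Hyp d} (h : -form x.1 y.1 = 1) : y = x := by
  have h0 : form x.1 y.1 = -1 := by linarith
  have h1 : y.1 - x.1 = 0 := by
    apply eq_zero_of_form_self x
    · rw [form_sub_right, x.2.1, h0]; ring
    · rw [form_sub_right, form_sub_left, form_sub_left, x.2.1, y.2.1, h0, form_comm y.1, h0]; ring
  exact Subtype.ext (sub_eq_zero.1 h1)

lemma tnorm_log (x y : Hyp d) : tnorm (log x y) = dist x y := by
  rcases eq_or_ne y x with rfl | h
  · rw [dist, y.2.1, tnorm]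
    simp [log, form_zero_left]
  have ha := one_le_neg_form x y
  have ha' : 1 < -form x.1 y.1 :=
    lt_of_le_of_ne ha fun h' => h (eq_of_neg_form_eq_one h'.symm)
  have hpos : 0 < (-form x.1 y.1) ^ 2 - 1 := by nlinarith
  have hdist : 0 ≤ dist x y := Real.arcosh_nonneg ha
  rw [tnorm, Real.sqrt_eq_iff_mul_self_eq (form_self_nonneg x (log x y).2)
    hdist]
  simp only [log, h, if_false, form_add_left, form_add_right, form_smul_left, form_smul_right,
    x.2.1, y.2.1, form_comm y.1 x.1]
  have hs := Real.sq_sqrt hpos.le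
  have hs0 : √((-form x.1 y.1) ^ 2 - 1) ≠ 0 := (Real.sqrt_pos.2 hpos).ne'
  generalize √((-form x.1 y.1) ^ 2 - 1) = q at hs hs0
  field_simp
  rw [hs]; ring

lemma geodesic_one (x y : Hyp d) : geodesic x y 1 = y := by
  apply Subtype.ext
  rw [geodesic_coe, one_mul, dir, tnorm_log]
  rcases eq_or_ne y x with rfl | h
  · have : dist y y = 0 := by rw [dist, y.2.1]; simp
    simp [this]
  have ha := one_le_neg_form x y
  have ha' : 1 < -form x.1 y.1 :=
    lt_of_le_of_ne ha fun h' => h (eq_of_neg_form_eq_one h'.symm)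
  have hpos : 0 < (-form x.1 y.1) ^ 2 - 1 := by nlinarith
  have hd : dist x y ≠ 0 := (Real.arcosh_pos ha').ne'
  have hs0 : √((-form x.1 y.1) ^ 2 - 1) ≠ 0 := (Real.sqrt_pos.2 hpos).ne'
  simp only [log, h, if_false]
  rw [smul_smul, smul_smul]
  have hc : Real.sinh (dist x y) * ((dist x y)⁻¹ * (dist x y / √((-form x.1 y.1) ^ 2 - 1)))
      = 1 := by
    rw [dist, Real.sinh_arcosh ha, ← dist]
    generalize √((-form x.1 y.1) ^ 2 - 1) = q at hs0
    field_simp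
  rw [← mul_assoc] at hc
  rw [hc, dist, Real.cosh_arcosh ha]
  simp

/-- The velocity of the geodesic from `x` to `y`, normalised to unit length. -/
def velocity (x y : Hyp d) (t : ℝ) : Fin (d + 1) → ℝ :=
  Real.sinh (t * tnorm (log x y)) • x.1 + Real.cosh (t * tnorm (log x y)) • dir x y

/-- Every tangent vector at a point of a geodesic extends to a parallel field. -/
lemma exists_parallel (x y : Hyp d) (s : ℝ) (w : Fin (d + 1) → ℝ)
    (hw : w ∈ tangent (geodesic x y s)) :
    ∃ V, IsParallel (geodesic x y) V ∧ V s = w := by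
  rcases dir_cases x y with ⟨h0, hu⟩ | hu
  · have hg : ∀ t, (geodesic x y t).1 = x.1 := fun t => by rw [geodesic_coe]; simp [h0]
    refine ⟨fun _ => w, ⟨fun t => ?_, differentiable_const _, fun t => ?_⟩, rfl⟩
    · change form _ _ = 0
      rw [hg t, ← hg s]; exact hw
    · simp [covDeriv, form_zero_right]
  · set r := tnorm (log x y) with hr
    have hxu := form_dir x y
    set u := dir x y with hudef
    set k := form (velocity x y s) w with hk
    have hwg : Real.cosh (s * r) * form x.1 w + Real.sinh (s * r) * form u w = 0 := by
      have : form (geodesic x y s).1 w = 0 := hw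
      rwa [geodesic_coe, form_add_left, form_smul_left, form_smul_left] at this
    have hkk : k = Real.sinh (s * r) * form x.1 w + Real.cosh (s * r) * form u w := by
      rw [hk, velocity, form_add_left, form_smul_left, form_smul_left]
    have hcs := Real.cosh_sq (s * r)
    have hxw : form x.1 w = -(Real.sinh (s * r)) * k := by
      rw [hkk]; linear_combination Real.cosh (s * r) * hwg - form x.1 w * hcs
    have huw : form u w = Real.cosh (s * r) * k := by
      rw [hkk]; linear_combination -Real.sinh (s * r) * hwg - form u w * hcs
    have hV : ∀ t, HasDerivAt (fun t => w - k • velocity x y s + k • velocity x y t)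
        ((k * r) • (geodesic x y t).1) t := by
      intro t
      have hl : HasDerivAt (fun t : ℝ => t * r) r t := by simpa using (hasDerivAt_id t).mul_const r
      have h1 := (hl.sinh.smul_const x.1).add (hl.cosh.smul_const u)
      have h2 := (h1.const_smul k).const_add (w - k • velocity x y s)
      have he : (k * r) • (geodesic x y t).1
          = k • ((Real.cosh (t * r) * r) • x.1 + (Real.sinh (t * r) * r) • u) := by
        rw [geodesic_coe]; module
      rw [he]
      exact h2
    refine ⟨fun t => w - k • velocity x y s + k • velocity x y t,
      ⟨fun t => ?_, fun t => (hV t).differentiableAt, fun t => ?_⟩, by simp⟩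
    · change form _ _ = 0
      simp only [geodesic_coe, velocity, form_add_left, form_add_right, form_smul_left,
        form_smul_right, form_sub_right, x.2.1, ← hr, ← hudef, hxu, form_comm u x.1, hu, hxw, huw]
      ring
    · rw [covDeriv, (hV t).deriv, form_smul_right, (geodesic x y t).2.1]
      module

/-- Two parallel fields along a curve that agree at one time agree at all times. -/
lemma IsParallel.unique {γ : ℝ → Hyp d} {V W : ℝ → Fin (d + 1) → ℝ} (hV : IsParallel γ V)
    (hW : IsParallel γ W) {s : ℝ} (h : V s = W s) (t : ℝ) : V t = W t := by
  have htan : ∀ t, form (γ t).1 (V t - W t) = 0 := fun t => by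
    have h1 : form (γ t).1 (V t) = 0 := hV.mem_tangent t
    have h2 : form (γ t).1 (W t) = 0 := hW.mem_tangent t
    rw [form_sub_right, h1, h2, sub_zero]
  have hD : ∀ t, HasDerivAt (fun t => V t - W t) (deriv V t - deriv W t) t := fun t =>
    (hV.differentiable t).hasDerivAt.sub (hW.differentiable t).hasDerivAt
  have hnorm : ∀ t, ∃ c : ℝ, deriv V t - deriv W t = c • (γ t).1 := fun t => by
    have h1 := hV.covDeriv_eq_zero t
    have h2 := hW.covDeriv_eq_zero t
    rw [covDeriv] at h1 h2
    refine ⟨-form (γ t).1 (deriv V t) + form (γ t).1 (deriv W t), ?_⟩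
    rw [← sub_eq_zero]
    refine Eq.trans ?_ ((congrArg₂ (· - ·) h1 h2).trans (sub_zero 0))
    module
  have hF : ∀ t, HasDerivAt (fun t => form (V t - W t) (V t - W t)) 0 t := fun t => by
    have hi : ∀ i, HasDerivAt (fun t => (V t - W t) i) ((deriv V t - deriv W t) i) t :=
      hasDerivAt_pi.1 (hD t)
    have hf : HasDerivAt (fun t => form (V t - W t) (V t - W t))
        (form (deriv V t - deriv W t) (V t - W t)
          + form (V t - W t) (deriv V t - deriv W t)) t := by
      have h1 := ((hi 0).mul (hi 0)).neg.add
        (HasDerivAt.fun_sum (u := Finset.univ)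
          (fun (j : Fin d) _ => (hi j.succ).mul (hi j.succ)))
      have he : form (deriv V t - deriv W t) (V t - W t)
          + form (V t - W t) (deriv V t - deriv W t)
          = -((deriv V t - deriv W t) 0 * (V t - W t) 0 + (V t - W t) 0 * (deriv V t - deriv W t) 0)
            + ∑ j : Fin d, ((deriv V t - deriv W t) j.succ * (V t - W t) j.succ
              + (V t - W t) j.succ * (deriv V t - deriv W t) j.succ) := by
        simp only [form, Finset.sum_add_distrib]
        ring
      rw [he]
      exact h1
    obtain ⟨c, hc⟩ := hnorm t
    rw [hc, form_smul_left, form_smul_right, form_comm _ (γ t).1, htan t] at hf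
    simpa using hf
  have hconst := is_const_of_deriv_eq_zero (fun t => (hF t).differentiableAt)
    (fun t => (hF t).deriv) t s
  have hz : form (V t - W t) (V t - W t) = 0 := by
    rw [hconst, h, sub_self, form_zero_left]
  exact sub_eq_zero.1 (eq_zero_of_form_self (γ t) (htan t) hz)

lemma existsUnique_transport (x y : Hyp d) (v : tangent x) : ∃! w, IsTransport x y v w := by
  obtain ⟨V, hV, h0⟩ := exists_parallel x y 0 v.1 (by rw [geodesic_zero]; exact v.2)
  have h1 : V 1 ∈ tangent y := by simpa only [geodesic_one] using hV.mem_tangent 1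
  refine ⟨⟨V 1, h1⟩, ⟨V, hV, h0, rfl⟩, ?_⟩
  rintro w ⟨W, hW, hW0, hW1⟩
  apply Subtype.ext
  rw [← hW1]
  exact hW.unique hV (hW0.trans h0.symm) 1

lemma existsUnique_transport_symm (x y : Hyp d) (w : tangent y) : ∃! v, IsTransport x y v w := by
  obtain ⟨V, hV, h1⟩ := exists_parallel x y 1 w.1 (by rw [geodesic_one]; exact w.2)
  have h0 : V 0 ∈ tangent x := by simpa only [geodesic_zero] using hV.mem_tangent 0
  refine ⟨⟨V 0, h0⟩, ⟨V, hV, rfl, h1⟩, ?_⟩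
  rintro v ⟨W, hW, hW0, hW1⟩
  apply Subtype.ext
  rw [← hW0]
  exact hW.unique hV (hW1.trans h1.symm) 0

end Transport

/-- Parallel transport `PT_{x → y} : T_x ℍ^d → T_y ℍ^d` along the geodesic from `x` to `y`, with
its inverse. -/
def transport {d : ℕ} (x y : Hyp d) : tangent x ≃ tangent y where
  toFun v := (existsUnique_transport x y v).choose
  invFun w := (existsUnique_transport_symm x y w).choose
  left_inv v := ((existsUnique_transport_symm x y _).choose_spec.2 v
    (existsUnique_transport x y v).choose_spec.1).symm
  right_inv w := ((existsUnique_transport x y _).choose_spec.2 w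
    (existsUnique_transport_symm x y w).choose_spec.1).symm

lemma isTransport_iff {d : ℕ} (x y : Hyp d) (v : tangent x) (w : tangent y) :
    IsTransport x y v w ↔ transport x y v = w :=
  ⟨fun h => ((existsUnique_transport x y v).choose_spec.2 w h).symm,
    fun h => h ▸ (existsUnique_transport x y v).choose_spec.1⟩

/-- The identification of `ℝ^d` with `T_o ℍ^d`, `v ↦ (0, v)`. -/
def originTangent (d : ℕ) : EuclideanSpace ℝ (Fin d) ≃ tangent (origin d) where
  toFun v := ⟨Fin.cons 0 v.ofLp, by change form _ _ = 0; simp [form, origin]⟩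
  invFun w := WithLp.toLp 2 (fun j => w.1 j.succ)
  left_inv v := by ext j; simp
  right_inv w := by
    have h : form (origin d).1 w.1 = 0 := w.2
    apply Subtype.ext
    funext i
    refine Fin.cases ?_ (fun j => ?_) i
    · simp [form, origin] at h; simp [h]
    · simp

/-- The wrapping map `v ↦ Exp_μ(PT_{o → μ} v)` from `ℝ^d ≅ T_o ℍ^d` to `ℍ^d`. -/
def wrap {d : ℕ} (μ : Hyp d) (v : EuclideanSpace ℝ (Fin d)) : Hyp d :=
  exp μ (transport (origin d) μ (originTangent d v))

/-- The coordinate map `T_μ(x) = PT_{o → μ}⁻¹ (Log_μ(x)) ∈ T_o ℍ^d ≅ ℝ^d`. -/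
def coord {d : ℕ} (μ x : Hyp d) : EuclideanSpace ℝ (Fin d) :=
  (originTangent d).symm ((transport (origin d) μ).symm (log μ x))

/-- The law `HWN_d(μ, S)` of `Exp_μ(PT_{o → μ} Z)`, where `Z ∼ N_d(0, S)`. -/
def hwn {d : ℕ} (μ : Hyp d) (S : Matrix (Fin d) (Fin d) ℝ) : Measure (Hyp d) :=
  (multivariateGaussian 0 S).map (wrap μ)

/-- The global chart of the manifold `ℍ^d` given by the spatial coordinates `(x₁, …, x_d)`, with
inverse parametrization `u ↦ (√(1 + ‖u‖²), u)`. -/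
def param (d : ℕ) : EuclideanSpace ℝ (Fin d) ≃ Hyp d where
  toFun u := ⟨Fin.cons √(1 + ‖u‖ ^ 2) u.ofLp, by
    have h : 0 ≤ 1 + ‖u‖ ^ 2 := by positivity
    simp only [form, Fin.cons_zero, Fin.cons_succ, Real.mul_self_sqrt h]
    rw [EuclideanSpace.real_norm_sq_eq]
    simp [pow_two], by simp only [Fin.cons_zero]; positivity⟩
  invFun x := WithLp.toLp 2 (fun j => x.1 j.succ)
  left_inv u := by ext j; simp
  right_inv x := by
    have h := x.2.1
    apply Subtype.ext
    funext i
    refine Fin.cases ?_ (fun j => ?_) i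
    · simp only [Fin.cons_zero, EuclideanSpace.real_norm_sq_eq]
      rw [Real.sqrt_eq_iff_mul_self_eq (by positivity) x.2.2.le]
      simp only [form, ← pow_two] at h ⊢
      linarith
    · simp

/-- The matrix `g_{ij}(u) = ⟨∂_i, ∂_j⟩_L` of the Riemannian metric of `ℍ^d` in the chart. -/
def metric {d : ℕ} (u : EuclideanSpace ℝ (Fin d)) : Matrix (Fin d) (Fin d) ℝ :=
  Matrix.of fun i j =>
    form (fderiv ℝ (fun u => (param d u).1) u (EuclideanSpace.single i 1))
      (fderiv ℝ (fun u => (param d u).1) u (EuclideanSpace.single j 1))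

/-- The Riemannian volume measure of `ℍ^d`, which is `√(det g(u)) du` in the global chart. -/
def hypVolume (d : ℕ) : Measure (Hyp d) :=
  ((volume : Measure (EuclideanSpace ℝ (Fin d))).withDensity
    fun u => ENNReal.ofReal √((metric u).det)).map (param d)

/-- The density `(2π)^(-d/2) |S|^(-1/2) exp(-½ T_μ(x)ᵀ S⁻¹ T_μ(x)) (r / sinh r)^(d-1)`, with
`r = r_μ(x) = ‖T_μ(x)‖`, the last factor being `1` at `x = μ`. -/
def hwnDensity {d : ℕ} (μ : Hyp d) (S : Matrix (Fin d) (Fin d) ℝ) (x : Hyp d) : ℝ :=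
  open Classical in
  (2 * Real.pi) ^ (-(d : ℝ) / 2) * S.det ^ (-(1 : ℝ) / 2)
    * Real.exp (-(1 / 2) * ((coord μ x).ofLp ⬝ᵥ S⁻¹.mulVec (coord μ x).ofLp))
    * if x = μ then 1 else (‖coord μ x‖ / Real.sinh ‖coord μ x‖) ^ (d - 1)

end Lorentz

end

/-! ### Parallel transport as a linear isometry, and the wrapping map as a measurable isomorphism -/

noncomputable section

namespace Lorentz

variable {d : ℕ}

/-! Both measures are pulled back to `ℝ^d` along `wrap μ`, that is, to normal coordinates at `μ`.
Parallel transport preserves the metric (`form_transport`), so it yields a linear isometry `frame μ`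
onto the tangent space. Hence `wrap μ` is a bijection with inverse `coord μ`, and `‖coord μ x‖` is
the distance to `μ`.

In these coordinates the hyperbolic metric is `1` in the radial direction and `(sinh r / r)²` in the
`d - 1` directions orthogonal to it (`form_wrapDeriv`). Its volume density is therefore `(sinh r /
r)^(d-1)`; comparing Gram determinants with those of the global chart (`jacobian_wrapChart`) and
changing variables gives `hypVolume_eq_map_wrap`.

The Gaussian has its usual Lebesgue density (`multivariateGaussian_zero_eq_withDensity`). Dividing
it by the volume density produces the factor `(r / sinh r)^(d-1)`. -/

lemma hasDerivAt_form {V W : ℝ → Fin (d + 1) → ℝ} {V' W' : Fin (d + 1) → ℝ} {t : ℝ}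
    (hV : HasDerivAt V V' t) (hW : HasDerivAt W W' t) :
    HasDerivAt (fun t => form (V t) (W t)) (form V' (W t) + form (V t) W') t := by
  have hv := hasDerivAt_pi.1 hV
  have hw := hasDerivAt_pi.1 hW
  have h1 := ((hv 0).mul (hw 0)).neg.add
    (HasDerivAt.fun_sum (u := Finset.univ) (fun (j : Fin d) _ => (hv j.succ).mul (hw j.succ)))
  refine h1.congr_deriv ?_
  simp only [form, Finset.sum_add_distrib]
  ring

/-- The form of two parallel fields along a curve is constant. -/
lemma IsParallel.form_eq {γ : ℝ → Hyp d} {V W : ℝ → Fin (d + 1) → ℝ} (hV : IsParallel γ V)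
    (hW : IsParallel γ W) (s t : ℝ) : form (V s) (W s) = form (V t) (W t) := by
  -- A parallel field has ambient derivative proportional to the position vector `γ t`, hence
  -- Lorentz-orthogonal to every tangent vector.
  have key : ∀ {X : ℝ → Fin (d + 1) → ℝ}, IsParallel γ X → ∀ t, ∀ w ∈ tangent (γ t),
      form (deriv X t) w = 0 := by
    intro X hX t w hw
    have h : form (deriv X t + form (γ t).1 (deriv X t) • (γ t).1) w = 0 := by
      rw [show deriv X t + form (γ t).1 (deriv X t) • (γ t).1 = 0 from hX.covDeriv_eq_zero t,
        form_zero_left]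
    have hw' : form (γ t).1 w = 0 := hw
    rwa [form_add_left, form_smul_left, hw', mul_zero, add_zero] at h
  have hD : ∀ t, HasDerivAt (fun t => form (V t) (W t)) 0 t := fun t => by
    refine (hasDerivAt_form (hV.differentiable t).hasDerivAt
      (hW.differentiable t).hasDerivAt).congr_deriv ?_
    rw [key hV t _ (hW.mem_tangent t), form_comm, key hW t _ (hV.mem_tangent t), add_zero]
  exact is_const_of_deriv_eq_zero (fun t => (hD t).differentiableAt) (fun t => (hD t).deriv) s t

/-- Parallel transport preserves the Riemannian metric. -/
lemma form_transport (x y : Hyp d) (v w : tangent x) :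
    form (transport x y v).1 (transport x y w).1 = form v.1 w.1 := by
  obtain ⟨V, hV, hV0, hV1⟩ := (isTransport_iff x y v _).2 rfl
  obtain ⟨W, hW, hW0, hW1⟩ := (isTransport_iff x y w _).2 rfl
  rw [← hV0, ← hW0, ← hV1, ← hW1, hV.form_eq hW 1 0]

lemma form_originTangent (v w : EuclideanSpace ℝ (Fin d)) :
    form (originTangent d v).1 (originTangent d w).1 = inner ℝ v w := by
  simp [form, originTangent, PiLp.inner_apply, mul_comm]

/-- The isometry `v ↦ PT_{o → μ} v` from `ℝ^d` onto `T_μ ℍ^d`, with values in `ℝ^(d+1)`. -/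
def frameFun (μ : Hyp d) (v : EuclideanSpace ℝ (Fin d)) : Fin (d + 1) → ℝ :=
  (transport (origin d) μ (originTangent d v)).1

lemma form_frameFun (μ : Hyp d) (v w : EuclideanSpace ℝ (Fin d)) :
    form (frameFun μ v) (frameFun μ w) = inner ℝ v w := by
  rw [frameFun, frameFun, form_transport, form_originTangent]

lemma form_self_frameFun (μ : Hyp d) (v : EuclideanSpace ℝ (Fin d)) :
    form μ.1 (frameFun μ v) = 0 :=
  form_tangent _

/-- The linear isometry `v ↦ PT_{o → μ} v` from `ℝ^d` onto `T_μ ℍ^d`, with values in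
`ℝ^(d+1)`. -/
def frame (μ : Hyp d) : EuclideanSpace ℝ (Fin d) →ₗ[ℝ] (Fin (d + 1) → ℝ) where
  toFun := frameFun μ
  -- Transport is defined by a choice, so linearity is not built in. The defect of additivity is
  -- tangent at `μ`, its form with itself expands to `0` because inner products are preserved, and
  -- the form is definite on tangent vectors.
  map_add' a b := by
    rw [← sub_eq_zero]
    apply eq_zero_of_form_self μ
    · simp [form_sub_right, form_add_right, form_self_frameFun]
    · simp only [form_sub_right, form_sub_left, form_add_left, form_add_right, form_frameFun,
        inner_add_left, inner_add_right]
      ring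
  map_smul' c a := by
    rw [← sub_eq_zero]
    apply eq_zero_of_form_self μ
    · simp [form_sub_right, form_smul_right, form_self_frameFun]
    · simp only [form_sub_right, form_sub_left, form_smul_left, form_smul_right, form_frameFun,
        real_inner_smul_left, real_inner_smul_right, RingHom.id_apply]
      ring

lemma form_frame (μ : Hyp d) (v w : EuclideanSpace ℝ (Fin d)) :
    form (frame μ v) (frame μ w) = inner ℝ v w := form_frameFun μ v w

lemma form_base_frame (μ : Hyp d) (v : EuclideanSpace ℝ (Fin d)) :
    form μ.1 (frame μ v) = 0 := form_self_frameFun μ v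

lemma frame_injective (μ : Hyp d) : Function.Injective (frame μ) := by
  rw [injective_iff_map_eq_zero]
  intro v hv
  have h := form_frame μ v v
  rw [hv, form_zero_left] at h
  exact inner_self_eq_zero.1 h.symm

lemma tnorm_transport (μ : Hyp d) (v : EuclideanSpace ℝ (Fin d)) :
    tnorm (transport (origin d) μ (originTangent d v)) = ‖v‖ := by
  rw [tnorm, form_transport, form_originTangent, real_inner_self_eq_norm_sq,
    Real.sqrt_sq (norm_nonneg v)]

lemma wrap_coe (μ : Hyp d) (v : EuclideanSpace ℝ (Fin d)) :
    (wrap μ v).1 = Real.cosh ‖v‖ • μ.1 + (Real.sinh ‖v‖ / ‖v‖) • frame μ v := by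
  simp only [wrap, exp, tnorm_transport, smul_smul, ← div_eq_mul_inv]
  rfl

lemma transport_coord (μ x : Hyp d) :
    transport (origin d) μ (originTangent d (coord μ x)) = log μ x := by
  simp [coord]

lemma frame_coord (μ x : Hyp d) : frame μ (coord μ x) = (log μ x).1 :=
  congrArg Subtype.val (transport_coord μ x)

lemma norm_coord (μ x : Hyp d) : ‖coord μ x‖ = dist μ x := by
  rw [← tnorm_transport μ, transport_coord, tnorm_log]

lemma wrap_coord (μ x : Hyp d) : wrap μ (coord μ x) = x := by
  rw [wrap, transport_coord]
  simpa [geodesic] using geodesic_one μ x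

lemma form_wrap (μ : Hyp d) (v : EuclideanSpace ℝ (Fin d)) :
    form μ.1 (wrap μ v).1 = -Real.cosh ‖v‖ := by
  rw [wrap_coe, form_add_right, form_smul_right, form_smul_right, form_base_frame, μ.2.1]
  ring

/-- Pairing with `μ` recovers `cosh ‖v‖` and hence the radius; with equal radii, injectivity of
`frame μ` recovers the vector. -/
lemma wrap_injective (μ : Hyp d) : Function.Injective (wrap μ) := by
  intro v w h
  have hn : ‖v‖ = ‖w‖ := by
    have h1 := form_wrap μ v
    rw [h, form_wrap, neg_inj] at h1
    have := Real.cosh_le_cosh.1 h1.le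
    have := Real.cosh_le_cosh.1 h1.ge
    simp only [abs_norm] at *
    linarith
  rcases eq_or_ne w 0 with rfl | hw
  · simpa using hn
  have hw' := norm_pos_iff.2 hw
  have h2 := congrArg Subtype.val h
  rw [wrap_coe, wrap_coe, hn, add_right_inj] at h2
  exact frame_injective μ
    (smul_right_injective _ (div_pos (Real.sinh_pos_iff.2 hw') hw').ne' h2)

lemma coord_wrap (μ : Hyp d) (v : EuclideanSpace ℝ (Fin d)) : coord μ (wrap μ v) = v :=
  wrap_injective μ (wrap_coord μ _)

lemma wrap_zero (μ : Hyp d) : wrap μ 0 = μ := by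
  apply Subtype.ext; simp [wrap_coe]

lemma wrap_eq_base_iff (μ : Hyp d) (v : EuclideanSpace ℝ (Fin d)) : wrap μ v = μ ↔ v = 0 := by
  nth_rw 2 [← wrap_zero μ]
  exact (wrap_injective μ).eq_iff

lemma measurable_form {α : Type*} [MeasurableSpace α] {f g : α → Fin (d + 1) → ℝ}
    (hf : Measurable f) (hg : Measurable g) : Measurable fun a => form (f a) (g a) := by
  have hf' := measurable_pi_iff.1 hf
  have hg' := measurable_pi_iff.1 hg
  unfold form; fun_prop

lemma measurable_wrap (μ : Hyp d) : Measurable (wrap μ) := by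
  refine Measurable.subtype_mk (f := fun v => (wrap μ v).1) ?_ (h := fun v => (wrap μ v).2)
  simp only [wrap_coe]
  have : Continuous (frame μ) := (frame μ).continuous_of_finiteDimensional
  fun_prop

lemma measurable_log (μ : Hyp d) : Measurable fun x => (log μ x).1 := by
  have hf : Measurable fun x : Hyp d => form μ.1 x.1 :=
    measurable_form measurable_const measurable_subtype_coe
  -- The formula away from `μ` also holds at `μ`: there `x + ⟨μ, x⟩_L μ` is already zero, so no case
  -- distinction remains.
  have hl : (fun x => (log μ x).1) = fun x =>
      (Real.arcosh (-form μ.1 x.1) / √((-form μ.1 x.1) ^ 2 - 1)) • (x.1 + form μ.1 x.1 • μ.1) := by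
    funext x
    unfold log
    split_ifs with h
    · subst h; simp [x.2.1]
    · rfl
  have ha : Measurable Real.arcosh := by unfold Real.arcosh; fun_prop
  rw [hl]
  fun_prop

lemma measurable_coord (μ : Hyp d) : Measurable (coord μ) := by
  -- Since `frame μ` is an isometry, its inverse is computed by pairing with the images of the
  -- standard basis, which are fixed vectors.
  have h : coord μ = fun x => WithLp.toLp 2 fun i =>
      form (log μ x).1 (frame μ (EuclideanSpace.single i 1)) := by
    funext x
    ext i
    simp only [← frame_coord, form_frame]
    simp [PiLp.inner_apply]
  have hl := measurable_log μ
  have : ∀ i, Measurable fun x =>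
      form (log μ x).1 (frame μ (EuclideanSpace.single i 1)) := fun i =>
    measurable_form hl measurable_const
  rw [h]
  fun_prop

/-- The wrapping map is a measurable isomorphism from `ℝ^d` to `ℍ^d`. -/
def wrapEquiv (μ : Hyp d) : EuclideanSpace ℝ (Fin d) ≃ᵐ Hyp d where
  toFun := wrap μ
  invFun := coord μ
  left_inv := coord_wrap μ
  right_inv := wrap_coord μ
  measurable_toFun := measurable_wrap μ
  measurable_invFun := measurable_coord μ

lemma measurable_param : Measurable (param d) := by
  refine Measurable.subtype_mk (f := fun v => (param d v).1) ?_ (h := fun v => (param d v).2)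
  refine measurable_pi_iff.2 fun i => Fin.cases ?_ (fun j => ?_) i
  · simp only [param, Equiv.coe_fn_mk, Fin.cons_zero]; fun_prop
  · simp only [param, Equiv.coe_fn_mk, Fin.cons_succ]; fun_prop

end Lorentz

end

/-! ### The Jacobian of the wrapping map -/

noncomputable section

namespace Lorentz

variable {d : ℕ}

lemma hasFDerivAt_norm {E : Type*} [NormedAddCommGroup E] [InnerProductSpace ℝ E] {v : E}
    (hv : v ≠ 0) : HasFDerivAt (fun v : E => ‖v‖) (‖v‖⁻¹ • innerSL ℝ v) v := by
  have h := ((hasStrictFDerivAt_norm_sq v).hasFDerivAt).sqrt (by simpa using hv)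
  simp only [Real.sqrt_sq (norm_nonneg _)] at h
  refine h.congr_fderiv ?_
  ext a
  simp
  field_simp

/-- The derivative at `v` of the wrapping map, with values in `ℝ^(d+1)`. -/
def wrapDeriv (μ : Hyp d) (v : EuclideanSpace ℝ (Fin d)) :
    EuclideanSpace ℝ (Fin d) →L[ℝ] (Fin (d + 1) → ℝ) :=
  (Real.sinh ‖v‖ • ‖v‖⁻¹ • innerSL ℝ v).smulRight μ.1
    + ((Real.sinh ‖v‖ / ‖v‖) • (frame μ).toContinuousLinearMap
      + (((Real.cosh ‖v‖ * ‖v‖ - Real.sinh ‖v‖) / ‖v‖ ^ 2) • ‖v‖⁻¹ • innerSL ℝ v).smulRight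
        (frame μ v))

lemma hasFDerivAt_wrap (μ : Hyp d) {v : EuclideanSpace ℝ (Fin d)} (hv : v ≠ 0) :
    HasFDerivAt (fun v => (wrap μ v).1) (wrapDeriv μ v) v := by
  have hn := hasFDerivAt_norm hv
  have hc := (Real.hasDerivAt_cosh ‖v‖).comp_hasFDerivAt v hn
  have hq : HasDerivAt (fun r : ℝ => Real.sinh r / r)
      ((Real.cosh ‖v‖ * ‖v‖ - Real.sinh ‖v‖) / ‖v‖ ^ 2) ‖v‖ := by
    simpa using (Real.hasDerivAt_sinh ‖v‖).fun_div (hasDerivAt_id' ‖v‖) (norm_ne_zero_iff.2 hv)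
  have hs := hq.comp_hasFDerivAt v hn
  have hf := (frame μ).toContinuousLinearMap.hasFDerivAt (x := v)
  simp only [wrap_coe]
  exact (hc.smul_const μ.1).add (hs.smul hf)

/-- The Gauss lemma in explicit form: the pulled-back metric is `(sinh r / r)²` times the Euclidean
one, plus a rank-one correction that restores unit scale along `v`. -/
lemma form_wrapDeriv (μ : Hyp d) {v : EuclideanSpace ℝ (Fin d)} (hv : v ≠ 0)
    (a b : EuclideanSpace ℝ (Fin d)) :
    form (wrapDeriv μ v a) (wrapDeriv μ v b)
      = (Real.sinh ‖v‖ / ‖v‖) ^ 2 * inner ℝ a b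
        + (1 - (Real.sinh ‖v‖ / ‖v‖) ^ 2) / ‖v‖ ^ 2 * (inner ℝ v a * inner ℝ v b) := by
  have hr := norm_ne_zero_iff.2 hv
  simp only [wrapDeriv, add_apply, ContinuousLinearMap.smulRight_apply,
    smul_apply, innerSL_apply_apply, LinearMap.coe_toContinuousLinearMap',
    form_add_left, form_add_right, form_smul_left, form_smul_right, form_frame, form_base_frame,
    form_comm (frame μ _) μ.1, μ.2.1, real_inner_self_eq_norm_sq, real_inner_comm v,
    smul_eq_mul]
  have hcs := Real.cosh_sq ‖v‖
  generalize ‖v‖ = r at hr hcs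
  field_simp
  linear_combination (inner ℝ v a * inner ℝ v b * r ^ 2) * hcs

/-- The Lorentz form as a bilinear form. -/
def formBilin (d : ℕ) : LinearMap.BilinForm ℝ (Fin (d + 1) → ℝ) :=
  LinearMap.mk₂ ℝ form (fun x y z => form_add_left x y z) (fun c x y => form_smul_left c x y)
    (fun x y z => form_add_right y z x) (fun c x y => form_smul_right c y x)

/-- The Gram matrix for the Lorentz form of the images of the standard basis. -/
def gram (D : EuclideanSpace ℝ (Fin d) →L[ℝ] (Fin (d + 1) → ℝ)) : Matrix (Fin d) (Fin d) ℝ :=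
  Matrix.of fun i j => form (D (EuclideanSpace.single i 1)) (D (EuclideanSpace.single j 1))

lemma gram_eq_toMatrix (D : EuclideanSpace ℝ (Fin d) →L[ℝ] (Fin (d + 1) → ℝ)) :
    gram D = LinearMap.BilinForm.toMatrix (EuclideanSpace.basisFun (Fin d) ℝ).toBasis
      ((formBilin d).comp D.toLinearMap D.toLinearMap) := by
  ext i j
  rw [LinearMap.BilinForm.toMatrix_apply]
  simp [gram, formBilin]

/-- The Gram matrix transforms as `G ↦ Aᵀ G A`. This is the chain rule for Riemannian volume
densities. -/
lemma det_gram_comp (D : EuclideanSpace ℝ (Fin d) →L[ℝ] (Fin (d + 1) → ℝ))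
    (A : EuclideanSpace ℝ (Fin d) →L[ℝ] EuclideanSpace ℝ (Fin d)) :
    (gram (D.comp A)).det = A.det ^ 2 * (gram D).det := by
  have h := LinearMap.BilinForm.toMatrix_comp (EuclideanSpace.basisFun (Fin d) ℝ).toBasis
    (EuclideanSpace.basisFun (Fin d) ℝ).toBasis
    ((formBilin d).comp D.toLinearMap D.toLinearMap) A.toLinearMap A.toLinearMap
  have hg : gram (D.comp A) = LinearMap.BilinForm.toMatrix (EuclideanSpace.basisFun (Fin d) ℝ).toBasis
      (((formBilin d).comp D.toLinearMap D.toLinearMap).comp A.toLinearMap A.toLinearMap) :=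
    gram_eq_toMatrix _
  rw [hg, h, ← gram_eq_toMatrix, Matrix.det_mul, Matrix.det_mul, Matrix.det_transpose,
    LinearMap.det_toMatrix, ContinuousLinearMap.det]
  ring

lemma det_gram_wrapDeriv (hd : 1 ≤ d) (μ : Hyp d) {v : EuclideanSpace ℝ (Fin d)} (hv : v ≠ 0) :
    (gram (wrapDeriv μ v)).det = ((Real.sinh ‖v‖ / ‖v‖) ^ (d - 1)) ^ 2 := by
  have hr := norm_pos_iff.2 hv
  have hs : Real.sinh ‖v‖ / ‖v‖ ≠ 0 := (div_pos (Real.sinh_pos_iff.2 hr) hr).ne'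
  have hvv : v.ofLp ⬝ᵥ v.ofLp = ‖v‖ ^ 2 := by
    rw [EuclideanSpace.real_norm_sq_eq]; simp [dotProduct, pow_two]
  -- Factoring out the scalar leaves the identity plus a rank-one matrix, ready for the matrix
  -- determinant lemma; the remaining factor is `1 + (1 - s²) / s² = s⁻²` with `s = sinh r / r`.
  have hg : gram (wrapDeriv μ v) = (Real.sinh ‖v‖ / ‖v‖) ^ 2 • (1 +
      Matrix.replicateCol Unit (((1 - (Real.sinh ‖v‖ / ‖v‖) ^ 2)
        / (‖v‖ ^ 2 * (Real.sinh ‖v‖ / ‖v‖) ^ 2)) • v.ofLp) * Matrix.replicateRow Unit v.ofLp) := by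
    ext i j
    simp only [gram, Matrix.of_apply, form_wrapDeriv μ hv]
    generalize Real.sinh ‖v‖ / ‖v‖ = s at hs
    have hij : inner ℝ (EuclideanSpace.single i (1 : ℝ)) (EuclideanSpace.single j (1 : ℝ))
        = (1 : Matrix (Fin d) (Fin d) ℝ) i j := by
      simp [PiLp.inner_apply, Matrix.one_apply]
    simp [hij, Matrix.mul_apply, PiLp.inner_apply]
    field_simp
  rw [hg, Matrix.det_smul, Matrix.det_one_add_replicateCol_mul_replicateRow, dotProduct_smul, hvv,
    Fintype.card_fin]
  generalize Real.sinh ‖v‖ / ‖v‖ = s at hs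
  obtain ⟨n, rfl⟩ := Nat.exists_eq_add_of_le' hd
  simp only [Nat.add_sub_cancel, smul_eq_mul]
  field_simp
  ring

/-- The wrapping map in the global chart. -/
def wrapChart (μ : Hyp d) (v : EuclideanSpace ℝ (Fin d)) : EuclideanSpace ℝ (Fin d) :=
  (param d).symm (wrap μ v)

lemma param_wrapChart (μ : Hyp d) (v : EuclideanSpace ℝ (Fin d)) :
    param d (wrapChart μ v) = wrap μ v := by simp [wrapChart]

/-- The projection to the spatial coordinates. -/
def spatial (d : ℕ) : (Fin (d + 1) → ℝ) →L[ℝ] EuclideanSpace ℝ (Fin d) :=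
  LinearMap.toContinuousLinearMap
    { toFun := fun x => WithLp.toLp 2 fun j => x j.succ
      map_add' := fun _ _ => rfl
      map_smul' := fun _ _ => rfl }

/-- The inverse of the chart parametrization is the restriction of the linear map `spatial d`, so
only `wrap μ` has to be differentiated. -/
lemma hasFDerivAt_wrapChart (μ : Hyp d) {v : EuclideanSpace ℝ (Fin d)} (hv : v ≠ 0) :
    HasFDerivAt (wrapChart μ) ((spatial d).comp (wrapDeriv μ v)) v :=
  (spatial d).hasFDerivAt.comp v (hasFDerivAt_wrap μ hv)

lemma differentiable_param : Differentiable ℝ fun u => (param d u).1 := by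
  refine differentiable_pi.2 fun i => Fin.cases ?_ (fun j => ?_) i
  · simp only [param, Equiv.coe_fn_mk, Fin.cons_zero]
    exact Differentiable.sqrt ((differentiable_id.norm_sq ℝ).const_add 1)
      fun u => by positivity
  · simp only [param, Equiv.coe_fn_mk, Fin.cons_succ]; fun_prop

/-- The Jacobian of the wrapping map for the Riemannian volume is `(sinh r / r)^(d-1)`. -/
lemma jacobian_wrapChart (hd : 1 ≤ d) (μ : Hyp d) {v : EuclideanSpace ℝ (Fin d)} (hv : v ≠ 0) :
    |((spatial d).comp (wrapDeriv μ v)).det| * √((metric (wrapChart μ v)).det)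
      = (Real.sinh ‖v‖ / ‖v‖) ^ (d - 1) := by
  have hr := norm_pos_iff.2 hv
  have hs : 0 < Real.sinh ‖v‖ / ‖v‖ := div_pos (Real.sinh_pos_iff.2 hr) hr
  set A := (spatial d).comp (wrapDeriv μ v)
  set D := fderiv ℝ (fun u => (param d u).1) (wrapChart μ v)
  -- Both sides are derivatives of the same map, since `param d` after `wrapChart μ` is `wrap μ`.
  have hD : D.comp A = wrapDeriv μ v := by
    have h1 := (differentiable_param (wrapChart μ v)).hasFDerivAt.comp v
      (hasFDerivAt_wrapChart μ hv)
    refine h1.unique ?_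
    have : (fun u => (param d u).1) ∘ wrapChart μ = fun v => (wrap μ v).1 := by
      funext w; simp [param_wrapChart]
    rw [this]
    exact hasFDerivAt_wrap μ hv
  have hdet := det_gram_comp D A
  rw [hD, det_gram_wrapDeriv hd μ hv] at hdet
  change _ * √((gram D).det) = _
  rw [← Real.sqrt_sq_eq_abs, ← Real.sqrt_mul (sq_nonneg _), ← hdet, Real.sqrt_sq (by positivity)]

end Lorentz

end

/-! ### Lebesgue densities of Gaussian measures -/

noncomputable section

/-- The standard Gaussian measure has density `(2π)^(-d/2) exp(-‖x‖²/2)`. -/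
lemma stdGaussian_eq_withDensity (d : ℕ) :
    stdGaussian (EuclideanSpace ℝ (Fin d)) = volume.withDensity fun x =>
      ENNReal.ofReal ((2 * Real.pi) ^ (-(d : ℝ) / 2) * Real.exp (-(1 / 2) * ‖x‖ ^ 2)) := by
  have hint : Integrable fun x : EuclideanSpace ℝ (Fin d) =>
      (2 * Real.pi) ^ (-(d : ℝ) / 2) * Real.exp (-(1 / 2) * ‖x‖ ^ 2) := by
    refine Integrable.const_mul ?_ _
    have := (GaussianFourier.integrable_cexp_neg_mul_sq_norm_add (V := EuclideanSpace ℝ (Fin d))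
      (b := 1 / 2) (by norm_num) 0 0).re
    refine this.congr (.of_forall fun x => ?_)
    have h : (-(1 / 2) * ‖x‖ ^ 2 : ℂ) = ((-(1 / 2) * ‖x‖ ^ 2 : ℝ) : ℂ) := by push_cast; ring
    change (Complex.exp _).re = _
    rw [zero_mul, add_zero, h, Complex.exp_ofReal_re]
  have : IsFiniteMeasure (volume.withDensity fun x : EuclideanSpace ℝ (Fin d) =>
      ENNReal.ofReal ((2 * Real.pi) ^ (-(d : ℝ) / 2) * Real.exp (-(1 / 2) * ‖x‖ ^ 2))) :=
    isFiniteMeasure_withDensity_ofReal hint.2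
  -- Finite measures are determined by their characteristic functions, and that of the density is a
  -- known Gaussian integral with `b = 1 / 2` and linear coefficient `i`.
  apply Measure.ext_of_charFun
  funext t
  rw [charFun_stdGaussian, charFun_apply, integral_withDensity_eq_integral_toReal_smul
    (by fun_prop) (.of_forall fun _ => ENNReal.ofReal_lt_top)]
  have h := GaussianFourier.integral_cexp_neg_mul_sq_norm_add (V := EuclideanSpace ℝ (Fin d))
      (b := 1 / 2) (by norm_num) Complex.I t
  have he : ∀ x : EuclideanSpace ℝ (Fin d),
      (ENNReal.ofReal ((2 * Real.pi) ^ (-(d : ℝ) / 2) * Real.exp (-(1 / 2) * ‖x‖ ^ 2))).toReal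
        • Complex.exp (inner ℝ x t * Complex.I)
      = (((2 * Real.pi) ^ (-(d : ℝ) / 2) : ℝ) : ℂ) *
        Complex.exp (-(1 / 2) * ‖x‖ ^ 2 + Complex.I * inner ℝ t x) := fun x => by
    rw [ENNReal.toReal_ofReal (by positivity), Complex.real_smul, Complex.exp_add,
      real_inner_comm]
    push_cast
    ring_nf
  simp_rw [he]
  rw [integral_const_mul, h, ← mul_assoc]
  -- The integral contributes `(π / b)^(d/2) = (2π)^(d/2)`, which cancels the normalising constant.
  have h1 : (((2 * Real.pi) ^ (-(d : ℝ) / 2) : ℝ) : ℂ) * ((Real.pi : ℂ) / (1 / 2)) ^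
      ((Module.finrank ℝ (EuclideanSpace ℝ (Fin d)) : ℂ) / 2) = 1 := by
    have h2 : (((2 * Real.pi) ^ ((d : ℝ) / 2) : ℝ) : ℂ) = ((Real.pi : ℂ) / (1 / 2)) ^
      ((Module.finrank ℝ (EuclideanSpace ℝ (Fin d)) : ℂ) / 2) := by
      rw [Complex.ofReal_cpow (by positivity), finrank_euclideanSpace_fin]
      push_cast
      congr 1
      ring
    rw [← h2, ← Complex.ofReal_mul, ← Real.rpow_add (by positivity)]
    simp [neg_div]
  rw [h1, one_mul, Complex.I_sq]
  congr 1
  ring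

/-- Serves for two pushforwards: by the square root of the covariance matrix, and by `wrap μ`. -/
lemma map_withDensity_comp {α β : Type*} [MeasurableSpace α] [MeasurableSpace β] {μ : Measure α}
    {e : α → β} (he : Measurable e) {f : β → ENNReal} (hf : Measurable f) :
    (μ.withDensity (f ∘ e)).map e = (μ.map e).withDensity f := by
  ext s hs
  rw [Measure.map_apply he hs, withDensity_apply _ (he hs), withDensity_apply _ hs,
    setLIntegral_map hs hf he]
  rfl

lemma measurable_dotProduct_mulVec {d : ℕ} (M : Matrix (Fin d) (Fin d) ℝ) :
    Measurable fun x : EuclideanSpace ℝ (Fin d) => x.ofLp ⬝ᵥ M.mulVec x.ofLp := by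
  simp only [dotProduct, Matrix.mulVec]; fun_prop

open scoped MatrixOrder in
/-- A multivariate Gaussian measure with positive definite covariance matrix has the usual density
with respect to Lebesgue measure. -/
lemma multivariateGaussian_zero_eq_withDensity {d : ℕ} {S : Matrix (Fin d) (Fin d) ℝ}
    (hS : S.PosDef) :
    multivariateGaussian 0 S = volume.withDensity fun x =>
      ENNReal.ofReal ((2 * Real.pi) ^ (-(d : ℝ) / 2) * S.det ^ (-(1 : ℝ) / 2)
        * Real.exp (-(1 / 2) * (x.ofLp ⬝ᵥ S⁻¹.mulVec x.ofLp))) := by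
  -- The Gaussian is the image of the standard one under `R = √S`, so its density comes from a
  -- linear change of variables with `|det R|⁻¹ = (det S)^(-1/2)`.
  set R := CFC.sqrt S
  have hRR : R * R = S := CFC.sqrt_mul_sqrt_self S hS.posSemidef.nonneg
  have hRT : R.transpose = R := by
    have h : R.PosSemidef := Matrix.nonneg_iff_posSemidef.1 (CFC.sqrt_nonneg S)
    simpa using h.isHermitian.eq
  have hdet : R.det ^ 2 = S.det := by rw [← hRR, Matrix.det_mul, pow_two]
  have hSd := hS.det_pos
  have hRd : R.det ≠ 0 := by
    intro h; rw [h] at hdet; simp at hdet; linarith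
  have hinv : R * (S⁻¹ * R) = 1 := by
    rw [← hRR, Matrix.mul_inv_rev, Matrix.mul_assoc, Matrix.nonsing_inv_mul _ hRd.isUnit,
      Matrix.mul_one, Matrix.mul_nonsing_inv _ hRd.isUnit]
  set A := Matrix.toEuclideanCLM (𝕜 := ℝ) R
  have hAd : LinearMap.det A.toLinearMap = R.det := LinearMap.det_toLpLin 2 R
  have hmap : (volume : Measure (EuclideanSpace ℝ (Fin d))).map A
      = ENNReal.ofReal (S.det ^ (-(1 : ℝ) / 2)) • volume := by
    have h := Measure.map_linearMap_addHaar_eq_smul_addHaar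
      (volume : Measure (EuclideanSpace ℝ (Fin d))) (f := A.toLinearMap) (by rwa [hAd])
    rw [hAd] at h
    refine h.trans ?_
    rw [abs_inv, ← Real.sqrt_sq_eq_abs, hdet, neg_div, Real.rpow_neg hSd.le,
      ← Real.sqrt_eq_rpow]
  set f : EuclideanSpace ℝ (Fin d) → ENNReal := fun x => ENNReal.ofReal
    ((2 * Real.pi) ^ (-(d : ℝ) / 2) * Real.exp (-(1 / 2) * (x.ofLp ⬝ᵥ S⁻¹.mulVec x.ofLp)))
  have hf : Measurable f := by
    have := measurable_dotProduct_mulVec S⁻¹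
    fun_prop
  -- Because `R S⁻¹ R = 1`, the quadratic form of `S⁻¹` at `R x` is `‖x‖²`.
  have hfA : f ∘ A = fun x => ENNReal.ofReal
      ((2 * Real.pi) ^ (-(d : ℝ) / 2) * Real.exp (-(1 / 2) * ‖x‖ ^ 2)) := by
    funext x
    have h : (A x).ofLp ⬝ᵥ S⁻¹.mulVec (A x).ofLp = ‖x‖ ^ 2 := by
      rw [Matrix.ofLp_toEuclideanCLM, Matrix.mulVec_mulVec]
      nth_rw 1 [← hRT]
      rw [Matrix.mulVec_transpose, ← Matrix.dotProduct_mulVec, Matrix.mulVec_mulVec, hinv,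
        Matrix.one_mulVec, EuclideanSpace.real_norm_sq_eq]
      simp [dotProduct, pow_two]
    simp only [f, Function.comp_apply, h]
  rw [multivariateGaussian, stdGaussian_eq_withDensity, ← hfA]
  simp only [zero_add]
  change (volume.withDensity (f ∘ A)).map A = _
  rw [map_withDensity_comp A.continuous.measurable hf, hmap, withDensity_smul_measure,
    ← withDensity_smul _ hf]
  congr 1
  funext x
  rw [Pi.smul_apply, smul_eq_mul, ← ENNReal.ofReal_mul (by positivity)]
  ring_nf

end

/-! ### Hyperbolic volume in normal coordinates, and the density -/

noncomputable section

namespace Lorentz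

variable {d : ℕ}

/-- The Riemannian volume measure in normal coordinates at `μ` is `(sinh r / r)^(d-1) dv`. -/
lemma hypVolume_eq_map_wrap (hd : 1 ≤ d) (μ : Hyp d) :
    hypVolume d = (volume.withDensity fun v : EuclideanSpace ℝ (Fin d) =>
      ENNReal.ofReal ((Real.sinh ‖v‖ / ‖v‖) ^ (d - 1))).map (wrap μ) := by
  have : Nonempty (Fin d) := ⟨⟨0, hd⟩⟩
  have hinj : Function.Injective (wrapChart μ) :=
    (param d).symm.injective.comp (wrap_injective μ)
  -- The derivative of `wrapChart μ` is known only off the origin, so the origin and its image are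
  -- removed; as `d ≥ 1`, points are Lebesgue null.
  have himg : wrapChart μ '' {0}ᶜ = {wrapChart μ 0}ᶜ := by
    have hbij : Function.Bijective (wrapChart μ) :=
      (param d).symm.bijective.comp (wrapEquiv μ).bijective
    rw [Set.image_compl_eq hbij, Set.image_singleton]
  have hr (a : EuclideanSpace ℝ (Fin d)) : volume.restrict {a}ᶜ = volume :=
    Measure.restrict_eq_self_of_ae_mem (by simp [ae_iff])
  ext s hs
  have hps := measurable_param hs
  have hws := measurable_wrap μ hs
  rw [hypVolume, Measure.map_apply measurable_param hs, Measure.map_apply (measurable_wrap μ) hs,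
    withDensity_apply _ hps, withDensity_apply _ hws, ← lintegral_indicator hps,
    ← lintegral_indicator hws]
  conv_lhs => rw [← hr (wrapChart μ 0), ← himg,
    lintegral_image_eq_lintegral_abs_det_fderiv_mul volume (measurableSet_singleton 0).compl
      (fun v hv => (hasFDerivAt_wrapChart μ hv).hasFDerivWithinAt) hinj.injOn]
  conv_rhs => rw [← hr 0]
  refine setLIntegral_congr_fun (measurableSet_singleton 0).compl fun v hv => ?_
  have hmem : wrapChart μ v ∈ param d ⁻¹' s ↔ v ∈ wrap μ ⁻¹' s := by
    simp [param_wrapChart]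
  by_cases hvs : v ∈ wrap μ ⁻¹' s
  · simp only [Set.indicator_of_mem hvs, Set.indicator_of_mem (hmem.2 hvs)]
    rw [← ENNReal.ofReal_mul (abs_nonneg _), jacobian_wrapChart hd μ hv]
  · simp only [Set.indicator_of_notMem hvs, Set.indicator_of_notMem (mt hmem.1 hvs), mul_zero]

lemma measurable_hwnDensity (μ : Hyp d) (S : Matrix (Fin d) (Fin d) ℝ) :
    Measurable (hwnDensity μ S) := by
  have hc := measurable_coord μ
  have hq := (measurable_dotProduct_mulVec S⁻¹).comp hc
  simp only [Function.comp_def] at hq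
  unfold hwnDensity
  refine Measurable.mul (by fun_prop) ?_
  exact Measurable.ite (measurableSet_singleton μ) measurable_const (by fun_prop)

/-- The volume Jacobian `(sinh r / r)^(d-1)` cancels the radial factor of the density and leaves the
Gaussian density. -/
lemma hwnDensity_wrap (μ : Hyp d) (S : Matrix (Fin d) (Fin d) ℝ) {v : EuclideanSpace ℝ (Fin d)}
    (hv : v ≠ 0) :
    (Real.sinh ‖v‖ / ‖v‖) ^ (d - 1) * hwnDensity μ S (wrap μ v)
      = (2 * Real.pi) ^ (-(d : ℝ) / 2) * S.det ^ (-(1 : ℝ) / 2)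
        * Real.exp (-(1 / 2) * (v.ofLp ⬝ᵥ S⁻¹.mulVec v.ofLp)) := by
  have hr := norm_pos_iff.2 hv
  have hs := Real.sinh_pos_iff.2 hr
  have h1 : (Real.sinh ‖v‖ / ‖v‖) ^ (d - 1) * (‖v‖ / Real.sinh ‖v‖) ^ (d - 1) = 1 := by
    rw [← mul_pow, div_mul_div_cancel₀ hr.ne', div_self hs.ne', one_pow]
  rw [hwnDensity, coord_wrap, if_neg (mt (wrap_eq_base_iff μ v).1 hv), mul_left_comm, h1, mul_one]

end Lorentz

end

theorem mainTheorem11 {d : ℕ} (hd : 2 ≤ d) (μ : Lorentz.Hyp d)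
    (S : Matrix (Fin d) (Fin d) ℝ) (hS : S.PosDef) :
    (∀ x, ‖Lorentz.coord μ x‖ = Lorentz.dist μ x) ∧
    Measurable (Lorentz.hwnDensity μ S) ∧
    Lorentz.hwn μ S =
      (Lorentz.hypVolume d).withDensity
        (fun x => ENNReal.ofReal (Lorentz.hwnDensity μ S x)) := by
  have hm := Lorentz.measurable_hwnDensity μ S
  refine ⟨Lorentz.norm_coord μ, hm, ?_⟩
  have : Nonempty (Fin d) := ⟨⟨0, by omega⟩⟩
  have hw := Lorentz.measurable_wrap μ
  -- Both sides become images under `wrap μ` of measures with Lebesgue densities on `ℝ^d`.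
  rw [Lorentz.hwn, multivariateGaussian_zero_eq_withDensity hS,
    Lorentz.hypVolume_eq_map_wrap (by omega) μ, ← map_withDensity_comp hw hm.ennreal_ofReal,
    ← withDensity_mul _ (by fun_prop) (hm.ennreal_ofReal.comp hw)]
  congr 1
  -- The densities differ at `v = 0`: there `sinh 0 / 0` is `0` by convention rather than the limit
  -- `1`, and `d - 1 > 0`. A single point is null.
  refine withDensity_congr_ae ?_
  have hne : ∀ᵐ v : EuclideanSpace ℝ (Fin d), v ≠ 0 := by simp [ae_iff]
  filter_upwards [hne] with v hv
  have hpos : 0 ≤ (Real.sinh ‖v‖ / ‖v‖) ^ (d - 1) :=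
    pow_nonneg (div_nonneg (Real.sinh_nonneg_iff.2 (norm_nonneg v)) (norm_nonneg v)) _
  rw [Pi.mul_apply, Function.comp_apply, ← ENNReal.ofReal_mul hpos, Lorentz.hwnDensity_wrap μ S hv]
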